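/- Let $K$ be a number field and let $\overline{\mathbb{Q}}$ be an algebraic closure of $K$. The house of $\alpha\in\overline{\mathbb{Q}}$ is $\overline{|\alpha|}=\max_{\sigma:\overline{\mathbb{Q}}\hookrightarrow\mathbb{C}}|\sigma(\alpha)|$, the maximum being taken over all field embeddings $\sigma$. For a subset $S\subseteq\overline{\mathbb{Q}}$, the Northcott number of $S$ with respect to the house is $$\mathcal N_{\rm house}(S)=\inf\bigl\{t\in[0,\infty) : \{\alpha\in S : \overline{|\alpha|}<t\}\ \text{is infinite}\bigr\}\in[0,\infty],\qquad \inf\emptyset=\infty.$$ For a field $F$ with $K\subseteq F\subseteq\overline{\mathbb{Q}}$, let $\mathcal O_F$ denote its ring of integers, i.e. the set of all elements of $F$ that are integral over $\mathbb{Z}$. **Theorem.** Let $C>0$ be a real constant and $K$ a number field. Then there are uncountably many algebraic extensions $F$ of $K$ (fields $K\subseteq F\subseteq\overline{\mathbb{Q}}$) such that $\mathcal N_{\rm house}(\mathcal O_F)>C$. -/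

import Mathlib

open scoped NNReal ENNReal

/-- The Northcott number of a set `S` with respect to a function `f` with values in `[0, ∞)`:
the infimum in `[0, ∞]` of all real `t ≥ 0` such that infinitely many `α ∈ S` satisfy `f α < t`.
The infimum of the empty set is `∞`. -/
noncomputable def northcottNumber {A : Type*} (f : A → ℝ≥0) (S : Set A) : ℝ≥0∞ :=
  sInf ((fun t : ℝ≥0 => (t : ℝ≥0∞)) '' {t : ℝ≥0 | {α : A | α ∈ S ∧ f α < t}.Infinite})

/-- The house of an element `α` of a field `A` which is algebraic over `ℚ` (such as an algebraic
closure of `ℚ`): the largest absolute value of `σ α`, for `σ` an embedding of `A` in `ℂ`.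
The supremum is a maximum, see `algHouse_isGreatest`. -/
noncomputable def algHouse {A : Type*} [Field A] (α : A) : ℝ≥0 :=
  ⨆ σ : A →+* ℂ, ‖σ α‖₊

theorem algHouse_isGreatest {A : Type*} [Field A] [CharZero A] [Algebra.IsAlgebraic ℚ A] (α : A) :
    IsGreatest (Set.range fun σ : A →+* ℂ => ‖σ α‖₊) (algHouse α) := by
  have hne : Nonempty (A →+* ℂ) := ⟨(IsAlgClosed.lift (R := ℚ) (S := A) (M := ℂ)).toRingHom⟩
  have hα : IsIntegral ℚ α := (Algebra.IsAlgebraic.isAlgebraic (R := ℚ) α).isIntegral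
  have hfin : (Set.range fun σ : A →+* ℂ => ‖σ α‖₊).Finite := by
    refine (((minpoly ℚ α).rootSet_finite ℂ).image fun z => ‖z‖₊).subset ?_
    rintro _ ⟨σ, rfl⟩
    refine ⟨σ α, ?_, rfl⟩
    rw [Polynomial.mem_rootSet]
    refine ⟨minpoly.ne_zero hα, ?_⟩
    have h := Polynomial.aeval_algHom_apply σ.toRatAlgHom α (minpoly ℚ α)
    rw [minpoly.aeval, map_zero] at h
    exact h
  exact ⟨(Set.range_nonempty _).csSup_mem hfin, fun x hx => le_csSup hfin.bddAbove hx⟩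

/-- The ring of integers `O_F` of an intermediate field `F` of `Ω / K`, as a subset of `Ω`:
the elements of `F` that are integral over `ℤ`. -/
def integersOf {K Ω : Type*} [Field K] [Field Ω] [Algebra K Ω] (F : IntermediateField K Ω) :
    Set Ω :=
  {α : Ω | α ∈ F ∧ IsIntegral ℤ α}

/-! Put `B = C + 1`. Starting from `K`, square roots `s n` of primes are adjoined one at a time so
that each step adds no integer of house at most `B`. All such integers of the union then lie in `K`,
where Northcott's theorem leaves finitely many. This passes to the subfields `K(s n : n ∈ A)`, which
are distinct for distinct `A ⊆ ℕ` because the roots are independent.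

The step (`exists_sqrt_forall_lt_norm`): if `α = x + y * s` is a new small integer over `L`, its
difference with its conjugate is `δ = 2 * y * s`, an integer of house at most `2B` with `δ ^ 2 ∈ L`.
Only finitely many such `δ` exist, whatever `s` is. Choosing `s` outside the finite extension they
generate over `L` forces `y = 0`. -/

/-! ### Quadratic extensions and independent square roots -/

open IntermediateField in
theorem IntermediateField.exists_add_mul_of_mem_sup_adjoin {K E : Type*} [Field K] [Field E]
    [Algebra K E] (L : IntermediateField K E) {s z : E} (hs : s ^ 2 ∈ L) (hz : z ∈ L ⊔ K⟮s⟯) :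
    ∃ x ∈ L, ∃ y ∈ L, z = x + y * s := by
  have hL : L ⊔ K⟮s⟯ = adjoin K ((L : Set E) ∪ {s}) := by rw [adjoin_union, adjoin_self]
  rw [hL] at hz
  induction hz using adjoin_induction with
  | mem x hx =>
    rcases hx with hx | hx
    · exact ⟨x, hx, 0, zero_mem _, by simp⟩
    · rw [Set.mem_singleton_iff] at hx
      exact ⟨0, zero_mem _, 1, one_mem _, by simp [hx]⟩
  | algebraMap x => exact ⟨_, L.algebraMap_mem x, 0, zero_mem _, by simp⟩
  | add z w _ _ h₁ h₂ =>
    obtain ⟨x, hx, y, hy, rfl⟩ := h₁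
    obtain ⟨u, hu, v, hv, rfl⟩ := h₂
    exact ⟨x + u, add_mem hx hu, y + v, add_mem hy hv, by ring⟩
  | mul z w _ _ h₁ h₂ =>
    obtain ⟨x, hx, y, hy, rfl⟩ := h₁
    obtain ⟨u, hu, v, hv, rfl⟩ := h₂
    exact ⟨x * u + y * v * s ^ 2, add_mem (mul_mem hx hu) (mul_mem (mul_mem hy hv) hs),
      x * v + y * u, add_mem (mul_mem hx hv) (mul_mem hy hu), by ring⟩
  | inv z _ h =>
    obtain ⟨x, hx, y, hy, rfl⟩ := h
    by_cases h₀ : x + y * s = 0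
    · exact ⟨0, zero_mem _, 0, zero_mem _, by simp [h₀]⟩
    by_cases h₁ : x - y * s = 0
    · have h₂ : x + y * s = 2 * x := by linear_combination -h₁
      have h₃ : (2 : E) ∈ L := ofNat_mem L 2
      exact ⟨(2 * x)⁻¹, inv_mem (mul_mem h₃ hx), 0, zero_mem _, by rw [h₂]; ring⟩
    · have hN : (x ^ 2 - y ^ 2 * s ^ 2)⁻¹ ∈ L :=
        inv_mem (sub_mem (pow_mem hx 2) (mul_mem (pow_mem hy 2) hs))
      refine ⟨x * (x ^ 2 - y ^ 2 * s ^ 2)⁻¹, mul_mem hx hN, -y * (x ^ 2 - y ^ 2 * s ^ 2)⁻¹,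
        mul_mem (neg_mem hy) hN, ?_⟩
      have h₄ : x ^ 2 - y ^ 2 * s ^ 2 = (x + y * s) * (x - y * s) := by ring
      rw [h₄]
      field_simp
      ring

theorem Nat.Prime.not_isSquare_mul {p q : ℕ} (hp : p.Prime) (hq : q.Prime) (hpq : p ≠ q) :
    ¬ IsSquare (p * q) := by
  rintro ⟨r, hr⟩
  have hpr : p ∣ r := by
    have : p ∣ r * r := ⟨q, hr.symm⟩
    exact (hp.dvd_mul.1 this).elim id id
  obtain ⟨k, rfl⟩ := hpr
  have h : q = p * (k * k) :=
    Nat.eq_of_mul_eq_mul_left hp.pos (by rw [hr]; ring)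
  exact hpq ((Nat.prime_dvd_prime_iff_eq hp hq).1 ⟨_, h⟩)

open IntermediateField in
/-- A number field does not contain square roots of all the prime numbers. -/
theorem NumberField.exists_prime_not_isSquare (M : Type*) [Field M] [NumberField M] :
    ∃ p : ℕ, p.Prime ∧ ¬ IsSquare (p : M) := by
  by_contra! H
  have : ∀ p : Nat.Primes, ∃ s : M, (p : M) = s ^ 2 := fun p => by
    simpa only [isSquare_iff_exists_sq] using H p p.2
  choose s hs using this
  have := Field.finite_intermediateField_of_exists_primitive_element ℚ M
    (Field.exists_primitive_element ℚ M)
  -- Pigeonhole: `M` has finitely many subfields, so two primes generate the same one.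
  obtain ⟨p, q, hpq, h⟩ := Finite.exists_ne_map_eq_of_infinite fun p => ℚ⟮s p⟯
  have hp : s p ∈ (⊥ : IntermediateField ℚ M) ⊔ ℚ⟮s q⟯ := by
    rw [bot_sup_eq, ← h]
    exact mem_adjoin_simple_self ℚ _
  obtain ⟨x, hx, y, hy, hxy⟩ := exists_add_mul_of_mem_sup_adjoin _ (by
    rw [← hs]; exact _root_.natCast_mem _ _) hp
  rw [mem_bot] at hx hy
  obtain ⟨x, rfl⟩ := hx
  obtain ⟨y, rfl⟩ := hy
  simp only [eq_ratCast] at hxy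
  have not_sq : ∀ (n : ℕ), ¬ IsSquare n → ∀ r : ℚ, (n : ℚ) ≠ r ^ 2 := fun n hn r hr =>
    hn (Rat.isSquare_natCast_iff.1 ⟨r, by rw [hr, sq]⟩)
  have key : ((p : ℕ) : M) = x ^ 2 + y ^ 2 * (q : ℕ) + 2 * x * y * s q := by
    rw [hs p, hxy, hs q]; ring
  by_cases hx0 : x = 0
  · refine not_sq _ (p.2.not_isSquare_mul q.2 (fun h => hpq (Subtype.ext h))) (y * q) ?_
    have : ((p : ℕ) : ℚ) = y ^ 2 * (q : ℕ) := by
      rw [hx0] at key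
      simp only [Rat.cast_zero] at key
      have : ((p : ℕ) : M) = y ^ 2 * (q : ℕ) := by rw [key]; ring
      exact_mod_cast this
    push_cast
    rw [this]; ring
  by_cases hy0 : y = 0
  · refine not_sq _ p.2.not_isSquare x ?_
    rw [hy0] at key
    simp only [Rat.cast_zero] at key
    have : ((p : ℕ) : M) = x ^ 2 := by rw [key]; ring
    exact_mod_cast this
  · refine not_sq _ q.2.not_isSquare (((p : ℕ) - x ^ 2 - y ^ 2 * (q : ℕ)) / (2 * x * y)) ?_
    have hx' : (x : M) ≠ 0 := by exact_mod_cast hx0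
    have hy' : (y : M) ≠ 0 := by exact_mod_cast hy0
    have : s q = ((((p : ℕ) - x ^ 2 - y ^ 2 * (q : ℕ)) / (2 * x * y) : ℚ) : M) := by
      push_cast
      rw [key]
      field_simp
      ring
    have h₂ := hs q
    rw [this] at h₂
    exact_mod_cast h₂

open IntermediateField in
/-- Square roots of elements of `K`, none of which lies in the field generated by its
predecessors, are independent. -/
theorem IntermediateField.mem_of_mem_adjoin_image {K E : Type*} [Field K] [Field E]
    [Algebra K E] {s : ℕ → E} (hsq : ∀ n, s n ^ 2 ∈ (⊥ : IntermediateField K E))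
    (hs : ∀ n, s n ∉ adjoin K (s '' Set.Iio n)) {A : Set ℕ} {n : ℕ}
    (hn : s n ∈ adjoin K (s '' A)) : n ∈ A := by
  have key : ∀ m, s n ∈ adjoin K (s '' (A ∩ Set.Iio m)) → n ∈ A := by
    intro m
    induction m with
    | zero =>
      intro h
      refine (hs n (adjoin.mono K _ _ (Set.image_mono ?_) h)).elim
      intro i hi
      exact absurd hi.2 (Nat.not_lt_zero i)
    | succ m ih =>
      intro h
      by_cases hm : m ∈ A
      · rcases lt_trichotomy n m with hnm | rfl | hnm
        · have heq : adjoin K (s '' (A ∩ Set.Iio (m + 1))) =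
              adjoin K (s '' (A ∩ Set.Iio m)) ⊔ K⟮s m⟯ := by
            rw [← adjoin_union, ← Set.image_singleton, ← Set.image_union]
            congr 2
            ext i
            simp only [Set.mem_inter_iff, Set.mem_Iio, Set.mem_union, Set.mem_singleton_iff]
            grind
          rw [heq] at h
          obtain ⟨x, hx, y, hy, hxy⟩ := exists_add_mul_of_mem_sup_adjoin _
            ((bot_le : ⊥ ≤ adjoin K (s '' (A ∩ Set.Iio m))) (hsq m)) h
          by_cases hy0 : y = 0
          · exact ih (by rw [hxy, hy0]; simpa using hx)
          -- A nonzero `y` lets `s m` be expressed through its predecessors, `s n` among them.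
          · refine (hs m ?_).elim
            have hle : adjoin K (s '' (A ∩ Set.Iio m)) ≤ adjoin K (s '' Set.Iio m) :=
              adjoin.mono K _ _ (Set.image_mono Set.inter_subset_right)
            have hsm : s m = (s n - x) / y := by rw [hxy]; field_simp; ring
            rw [hsm]
            exact div_mem (sub_mem (subset_adjoin K _ ⟨n, hnm, rfl⟩) (hle hx)) (hle hy)
        · exact hm
        · refine (hs n (adjoin.mono K _ _ (Set.image_mono ?_) h)).elim
          intro i hi
          have := hi.2
          simp only [Set.mem_Iio] at this ⊢
          omega
      · refine ih (adjoin.mono K _ _ (Set.image_mono ?_) h)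
        rintro i ⟨hi, him⟩
        refine ⟨hi, ?_⟩
        have : i ≠ m := fun h => hm (h ▸ hi)
        simp only [Set.mem_Iio] at him ⊢
        omega
  have hA : adjoin K (s '' A) = ⨆ m, adjoin K (s '' (A ∩ Set.Iio m)) := by
    rw [← adjoin_iUnion, ← Set.image_iUnion, ← Set.inter_iUnion, Set.iUnion_Iio, Set.inter_univ]
  have hmono : Monotone fun m => adjoin K (s '' (A ∩ Set.Iio m)) := fun i j hij =>
    adjoin.mono K _ _ (Set.image_mono (Set.inter_subset_inter_right _ (Set.Iio_subset_Iio hij)))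
  rw [hA, ← SetLike.mem_coe, coe_iSup_of_directed hmono.directed_le, Set.mem_iUnion] at hn
  obtain ⟨m, hm⟩ := hn
  exact key m hm

/-! ### Conjugates, houses and the tower -/

theorem nnnorm_le_algHouse {A : Type*} [Field A] [CharZero A] [Algebra.IsAlgebraic ℚ A]
    (σ : A →+* ℂ) (α : A) : ‖σ α‖₊ ≤ algHouse α :=
  (algHouse_isGreatest α).2 ⟨σ, rfl⟩

/-- By separability `s ∉ L` has another conjugate over `L`; its square is also `s ^ 2`, so it is
`-s`. -/
theorem IntermediateField.exists_algEquiv_neg {K Ω : Type*} [Field K] [CharZero K]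
    [Field Ω] [Algebra K Ω] [Algebra.IsAlgebraic K Ω] [IsAlgClosed Ω] (L : IntermediateField K Ω)
    {s : Ω} (hs : s ^ 2 ∈ L) (hsL : s ∉ L) : ∃ τ : Ω ≃ₐ[L] Ω, τ s = -s := by
  have : Algebra.IsAlgebraic L Ω := Algebra.IsAlgebraic.tower_top (K := K) L
  have hbot : s ∉ (⊥ : Subalgebra L Ω) := by
    rw [Algebra.mem_bot]
    rintro ⟨x, rfl⟩
    exact hsL x.2
  obtain ⟨y, hy, hc⟩ := (notMem_iff_exists_ne_and_isConjRoot
    (Algebra.IsSeparable.isSeparable L s) (IsAlgClosed.splits _)).1 hbot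
  have : Normal L Ω := normal_iff.2 fun x => ⟨Algebra.IsIntegral.isIntegral x, IsAlgClosed.splits _⟩
  obtain ⟨τ, hτ⟩ := hc.symm.exists_algEquiv
  refine ⟨τ, ?_⟩
  have h : τ s ^ 2 = s ^ 2 := by
    rw [← map_pow]
    exact τ.commutes ⟨s ^ 2, hs⟩
  rcases sq_eq_sq_iff_eq_or_eq_neg.1 h with h | h
  · exact absurd (hτ.symm.trans h) hy.symm
  · exact h

section

variable {K Ω : Type*} [Field K] [NumberField K] [Field Ω] [CharZero Ω] [Algebra K Ω]

theorem IntermediateField.numberField_of_finiteDimensional (L : IntermediateField K Ω)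
    [FiniteDimensional K L] : NumberField L where
  to_charZero := inferInstance
  to_finiteDimensional := FiniteDimensional.trans ℚ K L

variable [Algebra.IsAlgebraic K Ω]

/-- Northcott's theorem for the house. -/
theorem IntermediateField.finite_setOf_norm_le (L : IntermediateField K Ω)
    [FiniteDimensional K L] (B : ℝ) :
    {α : Ω | α ∈ L ∧ IsIntegral ℤ α ∧ ∀ σ : Ω →+* ℂ, ‖σ α‖ ≤ B}.Finite := by
  have := L.numberField_of_finiteDimensional
  refine ((NumberField.Embeddings.finite_of_norm_le L ℂ B).image (algebraMap L Ω)).subset ?_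
  rintro α ⟨hL, hα, hB⟩
  refine ⟨⟨α, hL⟩, ⟨?_, fun φ => ?_⟩, rfl⟩
  · rwa [← isIntegral_algebraMap_iff (algebraMap L Ω).injective]
  -- Every embedding of `L` extends to `Ω`, so the bounds over `Ω` suffice.
  · let := φ.toAlgebra
    have : Algebra.IsAlgebraic L Ω := Algebra.IsAlgebraic.tower_top (K := K) L
    let σ : Ω →ₐ[L] ℂ := IsAlgClosed.lift
    have h := hB σ.toRingHom
    have h₂ : σ (algebraMap L Ω ⟨α, hL⟩) = φ ⟨α, hL⟩ := σ.commutes _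
    rwa [← h₂]

variable [IsAlgClosed Ω]

open IntermediateField in
/-- A finite extension `L` of `K` has a quadratic extension, generated by the square root of an
element of `K`, all of whose new integers have large house. -/
theorem IntermediateField.exists_sqrt_forall_lt_norm (L : IntermediateField K Ω)
    [FiniteDimensional K L] (B : ℝ) :
    ∃ s : Ω, s ^ 2 ∈ (⊥ : IntermediateField K Ω) ∧ s ∉ L ∧
      ∀ α ∈ L ⊔ K⟮s⟯, IsIntegral ℤ α → (∀ σ : Ω →+* ℂ, ‖σ α‖ ≤ B) → α ∈ L := by
  set D : Set Ω := {δ | δ ^ 2 ∈ L ∧ IsIntegral ℤ δ ∧ ∀ σ : Ω →+* ℂ, ‖σ δ‖ ≤ 2 * B} with hD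
  have hDfin : D.Finite := by
    refine Set.Finite.subset (Set.Finite.preimage' (f := fun δ : Ω => δ ^ 2)
      (L.finite_setOf_norm_le ((2 * B) ^ 2)) fun b _ => ?_) ?_
    · refine (Multiset.finite_toSet (Polynomial.nthRoots 2 b)).subset fun δ hδ => ?_
      simpa [Polynomial.mem_nthRoots] using hδ
    · rintro δ ⟨h₁, h₂, h₃⟩
      refine ⟨h₁, h₂.pow 2, fun σ => ?_⟩
      rw [map_pow, norm_pow]
      exact pow_le_pow_left₀ (norm_nonneg _) (h₃ σ) 2
  have : Finite D := hDfin
  have : FiniteDimensional K (adjoin K D) :=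
    finiteDimensional_adjoin fun x _ => Algebra.IsIntegral.isIntegral x
  set M := L ⊔ adjoin K D with hM
  have := M.numberField_of_finiteDimensional
  obtain ⟨p, -, hp⟩ := NumberField.exists_prime_not_isSquare M
  obtain ⟨s, hs⟩ := IsAlgClosed.exists_pow_nat_eq (p : Ω) two_pos
  have hsM : s ∉ M := fun h => hp ⟨⟨s, h⟩, Subtype.ext (by simp [← hs, sq])⟩
  have hsL : s ∉ L := fun h => hsM ((le_sup_left : L ≤ M) h)
  have hs2 : ∀ F : IntermediateField K Ω, s ^ 2 ∈ F := fun F => hs ▸ _root_.natCast_mem F p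
  refine ⟨s, hs2 _, hsL, fun α hα hint hB => ?_⟩
  obtain ⟨x, hx, y, hy, rfl⟩ := exists_add_mul_of_mem_sup_adjoin L (hs2 L) hα
  by_cases hy0 : y = 0
  · simpa [hy0] using hx
  obtain ⟨τ, hτ⟩ := L.exists_algEquiv_neg (hs2 L) hsL
  have hτα : τ (x + y * s) = x - y * s := by
    have h₁ : τ x = x := τ.commutes ⟨x, hx⟩
    have h₂ : τ y = y := τ.commutes ⟨y, hy⟩
    rw [map_add, map_mul, h₁, h₂, hτ]; ring
  have hδ : 2 * y * s = (x + y * s) - τ (x + y * s) := by rw [hτα]; ring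
  have h2 : (2 : Ω) ∈ L := ofNat_mem L 2
  have hδD : 2 * y * s ∈ D := by
    refine ⟨?_, ?_, fun σ => ?_⟩
    · rw [mul_pow]
      exact mul_mem (pow_mem (mul_mem h2 hy) 2) (hs2 L)
    · rw [hδ]
      exact hint.sub (hint.map (τ.toAlgHom.restrictScalars ℤ))
    · rw [hδ, map_sub, two_mul]
      exact (norm_sub_le _ _).trans
        -- The bound on `τ α` is the hypothesis on `α` at the embedding `σ ∘ τ`.
        (add_le_add (hB σ) (hB (σ.comp (τ : Ω ≃+* Ω).toRingHom)))
  refine (hsM ?_).elim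
  have hsy : s = 2 * y * s / (2 * y) := by field_simp
  rw [hsy]
  exact div_mem ((le_sup_right : _ ≤ M) (subset_adjoin K _ hδD))
    ((le_sup_left : L ≤ M) (mul_mem h2 hy))

open IntermediateField in
/-- There is an infinite sequence of independent square roots of elements of `K` which generates
an extension of `K` all of whose new integers have large house. -/
theorem exists_sqrt_sequence (K Ω : Type*) [Field K] [NumberField K] [Field Ω] [CharZero Ω]
    [Algebra K Ω] [Algebra.IsAlgebraic K Ω] [IsAlgClosed Ω] (B : ℝ) :
    ∃ s : ℕ → Ω, (∀ n, s n ^ 2 ∈ (⊥ : IntermediateField K Ω)) ∧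
      (∀ n, s n ∉ adjoin K (s '' Set.Iio n)) ∧
      ∀ α ∈ adjoin K (Set.range s), IsIntegral ℤ α → (∀ σ : Ω →+* ℂ, ‖σ α‖ ≤ B) →
        α ∈ (⊥ : IntermediateField K Ω) := by
  choose f hf₁ hf₂ hf₃ using fun L : {L : IntermediateField K Ω // FiniteDimensional K L} =>
    haveI := L.2; L.1.exists_sqrt_forall_lt_norm B
  let next (L : {L : IntermediateField K Ω // FiniteDimensional K L}) :
      {L : IntermediateField K Ω // FiniteDimensional K L} :=
    ⟨L.1 ⊔ K⟮f L⟯, by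
      have := L.2
      have : FiniteDimensional K K⟮f L⟯ :=
        adjoin.finiteDimensional (Algebra.IsIntegral.isIntegral _)
      infer_instance⟩
  let L : ℕ → {L : IntermediateField K Ω // FiniteDimensional K L} := fun n =>
    Nat.rec ⟨⊥, inferInstance⟩ (fun _ => next) n
  have hL : ∀ n, (L n).1 = adjoin K ((fun n => f (L n)) '' Set.Iio n) := by
    intro n
    induction n with
    | zero =>
      have : Set.Iio 0 = (∅ : Set ℕ) := by ext; simp
      rw [this, Set.image_empty, adjoin_empty]
      rfl
    | succ n ih =>
      have h₁ : Set.Iio (n + 1) = Set.Iio n ∪ {n} := by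
        ext i
        simp only [Set.mem_Iio, Set.mem_union, Set.mem_singleton_iff]
        omega
      rw [h₁, Set.image_union, Set.image_singleton, adjoin_union, ← ih]
  refine ⟨fun n => f (L n), fun n => hf₁ _, fun n => hL n ▸ hf₂ (L n), fun α hα hint hB => ?_⟩
  have hsup : adjoin K (Set.range fun n => f (L n)) = ⨆ n, (L n).1 := by
    simp_rw [hL]
    rw [← adjoin_iUnion, ← Set.image_iUnion, Set.iUnion_Iio, Set.image_univ]
  have hmono : Monotone fun n => (L n).1 := monotone_nat_of_le_succ fun n => le_sup_left
  rw [hsup, ← SetLike.mem_coe, coe_iSup_of_directed hmono.directed_le, Set.mem_iUnion] at hα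
  obtain ⟨n, hn⟩ := hα
  rw [SetLike.mem_coe] at hn
  induction n with
  | zero => exact hn
  | succ n ih => exact ih (hf₃ (L n) α hn hint hB)

end

/-! ### Northcott numbers and uncountability -/

theorem le_northcottNumber {A : Type*} {f : A → ℝ≥0} {S : Set A} {B : ℝ≥0}
    (h : {α | α ∈ S ∧ f α ≤ B}.Finite) : (B : ℝ≥0∞) ≤ northcottNumber f S := by
  refine le_sInf ?_
  rintro _ ⟨t, ht, rfl⟩
  rw [ENNReal.coe_le_coe]
  by_contra! hlt
  exact ht (h.subset fun α hα => ⟨hα.1, (hα.2.trans hlt).le⟩)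

open IntermediateField in
theorem mainTheorem9 (C : ℝ) (hC : 0 < C) (K : Type*) [Field K] [NumberField K]
    (Ω : Type*) [Field Ω] [Algebra K Ω] [IsAlgClosure K Ω] :
    ¬ {F : IntermediateField K Ω |
        ENNReal.ofReal C < northcottNumber algHouse (integersOf F)}.Countable := by
  have : IsAlgClosed Ω := IsAlgClosure.isAlgClosed K
  have : Algebra.IsAlgebraic K Ω := IsAlgClosure.isAlgebraic
  have : CharZero Ω := charZero_of_injective_algebraMap (algebraMap K Ω).injective
  have : Algebra.IsAlgebraic ℚ Ω := Algebra.IsAlgebraic.trans ℚ K Ω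
  -- The slack of `1` gives strictness, as `le_northcottNumber` yields only `≤`.
  obtain ⟨s, hsq, hs, hB⟩ := exists_sqrt_sequence K Ω (C + 1)
  intro hcount
  have hinj : Function.Injective fun A : Set ℕ => adjoin K (s '' A) := by
    intro A A' (h : adjoin K (s '' A) = adjoin K (s '' A'))
    ext n
    exact ⟨fun hn => mem_of_mem_adjoin_image hsq hs (h ▸ subset_adjoin K _ ⟨n, hn, rfl⟩),
      fun hn => mem_of_mem_adjoin_image hsq hs (h.symm ▸ subset_adjoin K _ ⟨n, hn, rfl⟩)⟩
  have hgood : ∀ A : Set ℕ, ENNReal.ofReal C <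
      northcottNumber algHouse (integersOf (adjoin K (s '' A))) := by
    intro A
    have hlt : ENNReal.ofReal C < ((C + 1).toNNReal : ℝ≥0∞) :=
      (ENNReal.ofReal_lt_ofReal_iff (by linarith)).2 (by linarith)
    refine hlt.trans_le (le_northcottNumber ?_)
    refine ((⊥ : IntermediateField K Ω).finite_setOf_norm_le (C + 1)).subset ?_
    rintro α ⟨⟨hα, hint⟩, hle⟩
    have hnorm : ∀ σ : Ω →+* ℂ, ‖σ α‖ ≤ C + 1 := fun σ => by
      have h : ‖σ α‖₊ ≤ (C + 1).toNNReal := (nnnorm_le_algHouse σ α).trans hle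
      have h' := NNReal.coe_le_coe.2 h
      rwa [Real.coe_toNNReal _ (by linarith)] at h'
    exact ⟨hB α (adjoin.mono K _ _ (Set.image_subset_range s A) hα) hint hnorm, hint, hnorm⟩
  have hrange : (Set.range fun A : Set ℕ => adjoin K (s '' A)).Countable :=
    hcount.mono (by rintro _ ⟨A, rfl⟩; exact hgood A)
  have hSet : Countable (Set ℕ) := by
    have := hrange.to_subtype
    exact (Set.rangeFactorization_injective.2 hinj).countable
  obtain ⟨g, hg⟩ := exists_injective_nat (Set ℕ)
  exact Function.cantor_injective g hg
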